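/- Throughout, $G$ is a finite solvable group, and a \emph{maximal intersection} in $G$ is a subgroup of $G$ that is an intersection of maximal subgroups of $G$ (the empty intersection being $G$). For a real number $\eta>0$, a maximal intersection $H$ in $G$ is an \emph{$\eta$-intersection} if there are maximal subgroups $M_1,\dots,M_t$ of $G$ with $H=M_1\cap\dots\cap M_t$ and $|G:M_1|\cdots|G:M_t|\le |G:H|^{\eta}$. Let $V$ be an irreducible $G$-module, $F=\mathrm{End}_G(V)$, and let $\gamma$ be a positive integer. $V$ is a \emph{$\gamma$-module} if for every $F$-subspace $W$ of $V$ there is an $F$-subspace $W^*$ of $V$ such that $\dim_F(W^*)\le\gamma$ and $C_G(W)=C_G(W^*)\cap\bigcap_{M\in\mathcal M_W}M$, where $\mathcal M_W$ is the set of maximal subgroups of $G$ containing $C_G(W)$ (an empty intersection being $G$). For a maximal subgroup $M$ of $G$ let $Y_M=\bigcap_{g\in G}M^g$ be its normal core and let $X_M/Y_M$ be the socle of $G/Y_M$, regarded as a $G$-module under conjugation. For a maximal intersection $H$ in $G$ let $\mathcal V_H$ be the class of irreducible $G$-modules that are $G$-isomorphic to $X_M/Y_M$ for some maximal subgroup $M$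 of $G$ containing $H$. \textbf{Theorem.} Let $G$ be a finite solvable group, let $H$ be a maximal intersection in $G$ and let $\gamma$ be a positive integer. If every $V\in\mathcal V_H$ is a $\gamma$-module, then $H$ is a $(\gamma+1)$-intersection; that is, there are maximal subgroups $M_1,\dots,M_t$ of $G$ with $H=M_1\cap\dots\cap M_t$ and $\prod_{i=1}^t|G:M_i|\le|G:H|^{\gamma+1}$. -/

import Mathlib

universe u v

namespace MaxInt

section MaximalIntersections

variable {G : Type u} [Group G]

/-- `H` is a maximal intersection in `G`: the intersection of some set of maximal subgroups of `G`
(the empty intersection being `G` itself). -/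
def IsMaximalIntersection (H : Subgroup G) : Prop :=
  ∃ S : Set (Subgroup G), (∀ M ∈ S, IsCoatom M) ∧ H = sInf S

/-- `H` is an `η`-intersection in `G`: `H = M₁ ∩ ⋯ ∩ Mₜ` for a family of maximal subgroups with
`|G : M₁| ⋯ |G : Mₜ| ≤ |G : H| ^ η`. -/
def IsEtaIntersection (η : ℝ) (H : Subgroup G) : Prop :=
  ∃ (t : ℕ) (M : Fin t → Subgroup G), (∀ i, IsCoatom (M i)) ∧ H = ⨅ i, M i ∧
    ∏ i, ((M i).index : ℝ) ≤ (H.index : ℝ) ^ η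

end MaximalIntersections

section Socle

variable {G : Type u} [Group G]

/-- `N` is a minimal normal subgroup of `G`. -/
def IsMinimalNormal (N : Subgroup G) : Prop :=
  N.Normal ∧ N ≠ ⊥ ∧ ∀ K : Subgroup G, K.Normal → K ≤ N → K ≠ ⊥ → K = N

/-- The socle of a group: the subgroup generated by its minimal normal subgroups. -/
def socle (G : Type u) [Group G] : Subgroup G :=
  sSup {N : Subgroup G | IsMinimalNormal N}

instance socle_normal (G : Type u) [Group G] : (socle G).Normal :=
  Subgroup.sSup_normal _ fun _ hN => hN.1

/-- `X_M`, the preimage in `G` of the socle of `G / Y_M`, where `Y_M = M.normalCore` is the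
normal core of `M` in `G`. -/
def chiefTop (M : Subgroup G) : Subgroup G :=
  (socle (G ⧸ M.normalCore)).comap (QuotientGroup.mk' M.normalCore)

instance chiefTop_normal (M : Subgroup G) : (chiefTop M).Normal :=
  inferInstanceAs ((socle (G ⧸ M.normalCore)).comap (QuotientGroup.mk' M.normalCore)).Normal

/-- The factor `X_M / Y_M`. -/
abbrev ChiefFactor (M : Subgroup G) : Type u :=
  chiefTop M ⧸ M.normalCore.subgroupOf (chiefTop M)

end Socle

section Modules

variable (G : Type u) [Group G] (V : Type v) [AddCommGroup V] [DistribMulAction G V]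

/-- The `G`-module `V` is irreducible: it is nonzero, and `0` and `V` are its only
`G`-submodules. -/
def IsIrreducibleModule : Prop :=
  Nontrivial V ∧
    ∀ U : AddSubgroup V, (∀ (g : G), ∀ x ∈ U, g • x ∈ U) → U = ⊥ ∨ U = ⊤

/-- `End_G(V)`: the ring of additive endomorphisms of `V` that commute with the action of `G`.
It acts on `V` by evaluation. -/
abbrev EndG : Subring (AddMonoid.End V) :=
  Subring.centralizer (Set.range (DistribMulAction.toAddMonoidEnd G V))

/-- The `γ`-module property of an irreducible `G`-module `V`, with `F = End_G(V)`: for every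
`F`-subspace `W` of `V` there is an `F`-subspace `W'` of `V` with `dim_F W' ≤ γ` such that `C_G(W)`
is the intersection of `C_G(W')` and all the maximal subgroups of `G` that contain `C_G(W)`. -/
def IsGammaModule (γ : ℕ) : Prop :=
  ∀ W : Submodule (EndG G V) V, ∃ W' : Submodule (EndG G V) V,
    Module.rank (EndG G V) W' ≤ (γ : Cardinal) ∧
    fixingSubgroup G (W : Set V) =
      fixingSubgroup G (W' : Set V) ⊓
        sInf {M : Subgroup G | IsCoatom M ∧ fixingSubgroup G (W : Set V) ≤ M}

variable {G}

/-- The `G`-module `V` is `G`-isomorphic to `X_M / Y_M`, on which `G` acts by conjugation. -/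
def IsoChiefFactor (M : Subgroup G) : Prop :=
  ∃ e : ChiefFactor M ≃* Multiplicative V, ∀ (g : G) (x : chiefTop M),
    (e (QuotientGroup.mk (MulAut.conjNormal g x))).toAdd =
      g • (e (QuotientGroup.mk x)).toAdd

/-- `V` belongs to `𝒱_H`: it is an irreducible `G`-module that is `G`-isomorphic to `X_M / Y_M`
for some maximal subgroup `M` of `G` containing `H`. -/
def MemV (H : Subgroup G) : Prop :=
  IsIrreducibleModule G V ∧ ∃ M : Subgroup G, IsCoatom M ∧ H ≤ M ∧ IsoChiefFactor V M

end Modules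

end MaxInt

namespace MaxInt

/-! ### Derivations into an irreducible module and their zero subgroups. -/

section Derivations

variable {G : Type u} [Group G] {V : Type v} [AddCommGroup V] [DistribMulAction G V]

/-! Maximal subgroups are studied as zero sets of derivations. If `V` is irreducible with `C =
C_G(V)`, a derivation `d : G → V` not vanishing on `C` has a maximal subgroup of index `|V|` as zero
set (`isCoatom_zeros`, `index_zeros`). Conversely, every maximal `M` arises so from `V = X_M/Y_M`,
with `C = X_M` (`IsoChiefFactor.exists_der`, `IsoChiefFactor.cen_eq`).

Fix one such `V`, and let `Y` be the set of common zeros of the derivations vanishing on `H`. On `C`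
derivations are `G`-homomorphisms, so `k` of them cut out `C ∩ Y`, where `|C : C ∩ Y| = |V|^k` and
`k ≥ 1`. A derivation vanishing on `H` is a combination of these `k` plus one that vanishes on `C`;
since `H¹(G/C, V) = 0`, the latter is inner, given by a vector of `W = C_V(H)`. To control `W`, the
`γ`-module property needs only `γ` more maximal subgroups, together with maximal subgroups that
contain `C` and `H`. So `k + γ ≤ k(γ + 1)` maximal subgroups suffice for `V`, and their indices
multiply to at most `|C : C ∩ Y|^(γ+1)` (`exists_coatoms`).

A maximal `M' ≥ C = X_M` has `X_{M'} > X_M`, so the maximal subgroups above `C` are handled by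
induction down from large `X_M`. Finally, the product of `|C : C ∩ Y|` over isomorphism classes of
`V` is at most `|G : H|` (`prod_relIndex_commonZeros_le`): along a chief series, each factor
enlarges the contribution of at most one class. -/

theorem endG_smul_comm (f : EndG G V) (g : G) (v : V) : f • (g • v) = g • (f • v) := by
  have h := Subring.mem_centralizer_iff.1 f.2 (DistribMulAction.toAddMonoidEnd G V g) ⟨g, rfl⟩
  exact (DFunLike.congr_fun h v).symm

variable (G V) in
/-- The derivations (1-cocycles) from `G` to `V`. -/
def der : Submodule (EndG G V) (G → V) where
  carrier := {d | ∀ g h, d (g * h) = d g + g • d h}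
  add_mem' {a b} ha hb g h := by
    simp only [Pi.add_apply, ha g h, hb g h, smul_add]; abel
  zero_mem' g h := by simp
  smul_mem' f d hd g h := by
    simp only [Pi.smul_apply, hd g h, smul_add, endG_smul_comm]

theorem der_mul (d : der G V) (g h : G) : d.1 (g * h) = d.1 g + g • d.1 h := d.2 g h

@[simp] theorem der_one (d : der G V) : d.1 1 = 0 := by
  simpa using der_mul d 1 1

theorem der_inv (d : der G V) (g : G) : d.1 g⁻¹ = -(g⁻¹ • d.1 g) := by
  have := der_mul d g⁻¹ g
  rw [inv_mul_cancel, der_one] at this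
  exact eq_neg_of_add_eq_zero_left this.symm

/-- The subgroup of zeros of a derivation. -/
def zeros (d : der G V) : Subgroup G where
  carrier := {g | d.1 g = 0}
  mul_mem' {a b} ha hb := by
    simp only [Set.mem_ofPred_eq] at *
    rw [der_mul, ha, hb, smul_zero, add_zero]
  one_mem' := der_one d
  inv_mem' {a} ha := by
    simp only [Set.mem_ofPred_eq] at *
    rw [der_inv, ha, smul_zero, neg_zero]

theorem mem_zeros {d : der G V} {g : G} : g ∈ zeros d ↔ d.1 g = 0 := Iff.rfl

theorem inv_mul_mem_zeros {d : der G V} {g h : G} : g⁻¹ * h ∈ zeros d ↔ d.1 g = d.1 h := by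
  rw [mem_zeros, der_mul, der_inv, neg_add_eq_zero]
  exact (MulAction.injective g⁻¹).eq_iff

/-- The inner derivation `g ↦ g • w - w`. -/
def inner (w : V) : der G V :=
  ⟨fun g => g • w - w, fun g h => by simp only [mul_smul, smul_sub]; abel⟩

@[simp] theorem inner_apply (w : V) (g : G) : (inner w : der G V).1 g = g • w - w := rfl

theorem mem_zeros_inner {w : V} {g : G} : g ∈ zeros (inner w : der G V) ↔ g • w = w := by
  rw [mem_zeros, inner_apply, sub_eq_zero]

variable (G V) in
/-- The centralizer `C_G(V)` of the module `V`. -/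
def cen : Subgroup G := fixingSubgroup G (Set.univ : Set V)

theorem mem_cen {g : G} : g ∈ cen G V ↔ ∀ v : V, g • v = v := by
  simp [cen, mem_fixingSubgroup_iff]

instance cen_normal : (cen G V).Normal where
  conj_mem n hn g := by
    rw [mem_cen] at *
    intro v
    rw [mul_smul, mul_smul, hn, smul_inv_smul]

theorem der_mul_of_mem_cen (d : der G V) {c : G} (hc : c ∈ cen G V) (h : G) :
    d.1 (c * h) = d.1 c + d.1 h := by
  rw [der_mul, mem_cen.1 hc]

theorem der_conj (d : der G V) {c : G} (hc : c ∈ cen G V) (g : G) :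
    d.1 (g * c * g⁻¹) = g • d.1 c := by
  have h2 : d.1 (g * c * g⁻¹ * g) = d.1 (g * c * g⁻¹) + d.1 g :=
    der_mul_of_mem_cen d (cen_normal.conj_mem c hc g) g
  rw [inv_mul_cancel_right, der_mul] at h2
  exact (add_left_cancel ((add_comm _ _).trans h2.symm))

theorem inf_zeros_normal (d : der G V) (K : Subgroup G) [hK : K.Normal] (hKC : K ≤ cen G V) :
    (K ⊓ zeros d).Normal where
  conj_mem n hn g := Subgroup.mem_inf.2 ⟨hK.conj_mem n hn.1 g, by
    rw [mem_zeros, der_conj d (hKC hn.1), mem_zeros.1 hn.2, smul_zero]⟩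

theorem iInf_zeros_normal (s : Set (der G V)) (K : Subgroup G) [hK : K.Normal]
    (hKC : K ≤ cen G V) : (K ⊓ ⨅ d ∈ s, zeros d).Normal where
  conj_mem n hn g := Subgroup.mem_inf.2 ⟨hK.conj_mem n hn.1 g, by
    have h2 := (Subgroup.mem_inf.1 hn).2
    simp only [Subgroup.mem_iInf] at h2 ⊢
    intro d hd
    rw [mem_zeros, der_conj d (hKC hn.1), mem_zeros.1 (h2 d hd), smul_zero]⟩

/-- The fixed points of a normal subgroup form a submodule, so one nonzero fixed vector forces
trivial action. -/
theorem le_cen_of_fixed (hV : IsIrreducibleModule G V) (N : Subgroup G) [hN : N.Normal] {v : V}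
    (hv : v ≠ 0) (h : ∀ n ∈ N, n • v = v) : N ≤ cen G V := by
  let U : AddSubgroup V :=
    { carrier := {x | ∀ n ∈ N, n • x = x}
      add_mem' := fun {a b} ha hb n hn => by rw [smul_add, ha n hn, hb n hn]
      zero_mem' := fun n _ => smul_zero n
      neg_mem' := fun {a} ha n hn => by rw [smul_neg, ha n hn] }
  rcases hV.2 U (fun g x hx n hn => by
      have := hx (g⁻¹ * n * g) (by simpa using hN.conj_mem n hn g⁻¹)
      rw [mul_smul, mul_smul, inv_smul_eq_iff] at this
      exact this) with hU | hU
  · have : v ∈ U := h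
    rw [hU] at this
    exact (hv this).elim
  · intro n hn
    rw [mem_cen]
    intro x
    have : x ∈ U := hU ▸ AddSubgroup.mem_top x
    exact this n hn

/-- On `K ≤ C_G(V)` a derivation is a `G`-equivariant homomorphism, so its image is a submodule:
zero or everything. -/
theorem der_surjOn (hV : IsIrreducibleModule G V) (K : Subgroup G) [hK : K.Normal]
    (hKC : K ≤ cen G V) (d : der G V) (hd : ¬ K ≤ zeros d) (v : V) : ∃ k ∈ K, d.1 k = v := by
  let U : AddSubgroup V :=
    { carrier := {x | ∃ k ∈ K, d.1 k = x}
      add_mem' := by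
        rintro a b ⟨k, hk, rfl⟩ ⟨l, hl, rfl⟩
        exact ⟨k * l, mul_mem hk hl, der_mul_of_mem_cen d (hKC hk) l⟩
      zero_mem' := ⟨1, one_mem _, der_one d⟩
      neg_mem' := by
        rintro a ⟨k, hk, rfl⟩
        exact ⟨k⁻¹, inv_mem hk, by rw [der_inv, mem_cen.1 (inv_mem (hKC hk))]⟩ }
  rcases hV.2 U (by
      rintro g x ⟨k, hk, rfl⟩
      exact ⟨g * k * g⁻¹, hK.conj_mem k hk g, der_conj d (hKC hk) g⟩) with hU | hU
  · refine (hd fun k hk => ?_).elim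
    have : d.1 k ∈ U := ⟨k, hk, rfl⟩
    rw [hU] at this
    exact this
  · have : v ∈ U := hU ▸ AddSubgroup.mem_top v
    exact this

theorem index_zeros (hV : IsIrreducibleModule G V) (d : der G V) (hd : ¬ cen G V ≤ zeros d) :
    (zeros d).index = Nat.card V := by
  refine Nat.card_congr (Equiv.ofBijective
    (Quotient.lift d.1 fun a b hab => inv_mul_mem_zeros.1 (QuotientGroup.leftRel_apply.1 hab))
    ⟨?_, ?_⟩)
  · rintro ⟨a⟩ ⟨b⟩ hab
    exact Quotient.sound (QuotientGroup.leftRel_apply.2 (inv_mul_mem_zeros.2 hab))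
  · intro v
    obtain ⟨k, -, hk⟩ := der_surjOn hV (cen G V) le_rfl d hd v
    exact ⟨Quotient.mk _ k, hk⟩

theorem relIndex_zeros (hV : IsIrreducibleModule G V) (K : Subgroup G) [hK : K.Normal]
    (hKC : K ≤ cen G V) (d : der G V) (hd : ¬ K ≤ zeros d) :
    (zeros d).relIndex K = Nat.card V := by
  have key : ∀ a b : K, a⁻¹ * b ∈ (zeros d).subgroupOf K ↔ d.1 a = d.1 b := fun a b => by
    rw [Subgroup.mem_subgroupOf]
    exact inv_mul_mem_zeros
  refine Nat.card_congr (Equiv.ofBijective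
    (Quotient.lift (fun k : K => d.1 k)
      fun a b hab => (key a b).1 (QuotientGroup.leftRel_apply.1 hab))
    ⟨?_, ?_⟩)
  · rintro ⟨a⟩ ⟨b⟩ hab
    exact Quotient.sound (QuotientGroup.leftRel_apply.2 ((key a b).2 hab))
  · intro v
    obtain ⟨k, hk', hk⟩ := der_surjOn hV K hKC d hd v
    exact ⟨Quotient.mk _ ⟨k, hk'⟩, hk⟩

/-- `C_G(V)` and `zeros d` generate `G`. If `K` properly contains `zeros d`, then `K ⊓ cen G V` is
normal and `d` is nonzero on it, hence onto `V`; so `K` meets every coset of `zeros d`. -/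
theorem isCoatom_zeros (hV : IsIrreducibleModule G V) (d : der G V) (hd : ¬ cen G V ≤ zeros d) :
    IsCoatom (zeros d) := by
  refine ⟨fun h => hd (h ▸ le_top), fun K hK => ?_⟩
  have hdec : ∀ g : G, ∃ c ∈ cen G V, c⁻¹ * g ∈ zeros d := fun g => by
    obtain ⟨c, hc, h⟩ := der_surjOn hV (cen G V) le_rfl d hd (d.1 g)
    exact ⟨c, hc, inv_mul_mem_zeros.2 h⟩
  have hN : (K ⊓ cen G V).Normal := by
    refine ⟨fun x hx g => ⟨?_, cen_normal.conj_mem x hx.2 g⟩⟩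
    obtain ⟨c, hc, hm⟩ := hdec g
    have hy : c⁻¹ * g * x * (c⁻¹ * g)⁻¹ ∈ K :=
      mul_mem (mul_mem (hK.le hm) hx.1) (inv_mem (hK.le hm))
    have hyC := cen_normal.conj_mem x hx.2 (c⁻¹ * g)
    set y := c⁻¹ * g * x * (c⁻¹ * g)⁻¹ with hy_def
    -- Conjugation by `c ∈ C_G(V)` does not change the value of `d` on `C_G(V)`, so it moves `y`
    -- only by an element of `zeros d ≤ K`.
    have h1 : y⁻¹ * (c * y * c⁻¹) ∈ zeros d := by
      rw [inv_mul_mem_zeros, der_conj d hyC, mem_cen.1 hc]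
    have h2 := mul_mem hy (hK.le h1)
    have h3 : y * (y⁻¹ * (c * y * c⁻¹)) = g * x * g⁻¹ := by rw [hy_def]; group
    rwa [h3] at h2
  obtain ⟨k, hkK, hk⟩ := SetLike.exists_of_lt hK
  have hne : ¬ K ⊓ cen G V ≤ zeros d := by
    intro h
    obtain ⟨c, hc, hm⟩ := hdec k
    have hcK : c ∈ K := by
      have := K.mul_mem hkK (K.inv_mem (hK.le hm))
      simpa using this
    have hcz : c ∈ zeros d := h ⟨hcK, hc⟩
    apply hk
    simpa using mul_mem hcz hm
  refine eq_top_iff.2 fun g _ => ?_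
  obtain ⟨x, hx, hxg⟩ := der_surjOn hV (K ⊓ cen G V) inf_le_right d hne (d.1 g)
  have := K.mul_mem hx.1 (hK.le (inv_mul_mem_zeros.2 hxg))
  simpa using this

/-- The comparison endomorphism of two homomorphisms on a normal subgroup `K ≤ C_G(V)`. -/
theorem exists_smul_eq (hV : IsIrreducibleModule G V) (K : Subgroup G) [hK : K.Normal]
    (hKC : K ≤ cen G V) (d e : der G V) (h : K ⊓ zeros d ≤ zeros e) :
    ∃ f : EndG G V, ∀ k ∈ K, e.1 k = f • d.1 k := by
  by_cases hd : K ≤ zeros d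
  · exact ⟨0, fun k hk => by rw [zero_smul]; exact h ⟨hk, hd hk⟩⟩
  -- The endomorphism is `d k ↦ e k`, computed on chosen preimages `p v`; `key` is its independence
  -- of that choice.
  choose p hpK hp using der_surjOn hV K hKC d hd
  have key : ∀ k ∈ K, e.1 (p (d.1 k)) = e.1 k := fun k hk =>
    inv_mul_mem_zeros.1 (h ⟨K.mul_mem (K.inv_mem (hpK _)) hk, inv_mul_mem_zeros.2 (hp _)⟩)
  let f : AddMonoid.End V :=
    { toFun := fun v => e.1 (p v)
      map_zero' := by
        have := key 1 (one_mem K)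
        rwa [der_one, der_one] at this
      map_add' := fun v w => by
        have h1 : d.1 (p v * p w) = v + w := by
          rw [der_mul_of_mem_cen d (hKC (hpK v)), hp, hp]
        have := key _ (mul_mem (hpK v) (hpK w))
        rwa [h1, der_mul_of_mem_cen e (hKC (hpK v))] at this }
  have hf : f ∈ EndG G V := by
    rw [Subring.mem_centralizer_iff]
    rintro _ ⟨g, rfl⟩
    ext v
    change g • e.1 (p v) = e.1 (p (g • v))
    have := key _ (hK.conj_mem _ (hpK v) g)
    rw [der_conj d (hKC (hpK v)), hp, der_conj e (hKC (hpK v))] at this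
    exact this.symm
  exact ⟨⟨f, hf⟩, fun k hk => (key k hk).symm⟩

/-- The analogue of the fact that a functional vanishing on a common kernel is a combination of the
given ones. Each induction step shrinks `K` to `K ⊓ zeros d`, which is why `K` is quantified inside.
-/
theorem exists_mem_span (hV : IsIrreducibleModule G V) (s : Finset (der G V)) :
    ∀ (K : Subgroup G) [K.Normal], K ≤ cen G V → ∀ e : der G V,
      K ⊓ (⨅ d ∈ s, zeros d) ≤ zeros e →
      ∃ e' ∈ Submodule.span (EndG G V) (s : Set (der G V)), ∀ k ∈ K, e.1 k = e'.1 k := by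
  classical
  induction s using Finset.induction_on with
  | empty =>
    intro K _ hKC e h
    exact ⟨0, zero_mem _, fun k hk => h (by simpa using hk)⟩
  | insert d s _ ih =>
    intro K _ hKC e h
    have := inf_zeros_normal d K hKC
    rw [Finset.iInf_insert, ← inf_assoc] at h
    obtain ⟨e', he', hk⟩ := ih (K ⊓ zeros d) (inf_le_left.trans hKC) e h
    obtain ⟨f, hf⟩ := exists_smul_eq hV K hKC d (e - e') (fun k hk' => by
      have := hk k hk'
      rw [mem_zeros]
      simp [this])
    refine ⟨e' + f • d, add_mem (Submodule.span_mono (by simp) he')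
      (Submodule.smul_mem _ _ (Submodule.subset_span (by simp))), fun k hkK => ?_⟩
    have := hf k hkK
    simp only [Submodule.coe_sub, Pi.sub_apply, Submodule.coe_add, Pi.add_apply,
      Submodule.coe_smul, Pi.smul_apply] at this ⊢
    rw [← this]; abel

/-- Greedy choice of a basis: on the normal subgroup cut out so far, the next derivation either
vanishes and is dropped, or is onto and contributes a full factor `|V|`. -/
theorem exists_subset_relIndex (hV : IsIrreducibleModule G V) (K : Subgroup G) [K.Normal]
    (hKC : K ≤ cen G V) (s : Finset (der G V)) :
    ∃ t ⊆ s, (∀ d ∈ t, ¬ K ≤ zeros d) ∧ K ⊓ (⨅ d ∈ t, zeros d) = K ⊓ (⨅ d ∈ s, zeros d) ∧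
      (⨅ d ∈ t, zeros d).relIndex K = Nat.card V ^ t.card := by
  classical
  induction s using Finset.induction_on with
  | empty => exact ⟨∅, le_rfl, by simp, rfl, by simp⟩
  | insert d s hds ih =>
    obtain ⟨t, hts, hne, heq, hcard⟩ := ih
    have hn : (K ⊓ ⨅ d ∈ t, zeros d).Normal := iInf_zeros_normal (t : Set (der G V)) K hKC
    by_cases h : K ⊓ (⨅ d ∈ t, zeros d) ≤ zeros d
    · refine ⟨t, hts.trans (Finset.subset_insert _ _), hne, ?_, hcard⟩
      rw [Finset.iInf_insert, inf_left_comm, ← heq, inf_eq_right.2 h]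
    · refine ⟨insert d t, Finset.insert_subset_insert d hts, ?_, ?_, ?_⟩
      · exact Finset.forall_mem_insert _ _ _ |>.2 ⟨fun h' => h (inf_le_left.trans h'), hne⟩
      · rw [Finset.iInf_insert, Finset.iInf_insert, inf_left_comm, heq, inf_left_comm]
      · rw [Finset.iInf_insert, Finset.card_insert_of_notMem (fun h' => hds (hts h')),
          ← Subgroup.relIndex_inf_mul_relIndex, inf_comm _ K,
          relIndex_zeros hV _ (inf_le_left.trans hKC) d h, hcard, pow_succ']

theorem le_zeros_of_mem_span {s : Set (der G V)} {I : Subgroup G} (h : ∀ d ∈ s, I ≤ zeros d)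
    {e : der G V} (he : e ∈ Submodule.span (EndG G V) s) : I ≤ zeros e := by
  intro g hg
  refine Submodule.span_induction (p := fun e _ => g ∈ zeros e) (fun d hd => h d hd hg) rfl
    (fun x y _ _ hx hy => ?_) (fun a x _ hx => ?_) he
  · rw [mem_zeros] at *
    simp [hx, hy]
  · rw [mem_zeros] at *
    simp [hx]

end Derivations

/-! ### Vanishing of cohomology, and the maximal subgroups needed for a single module. -/

section Local

variable {G : Type u} [Group G] {V : Type v} [AddCommGroup V] [DistribMulAction G V]

/-- `N` is the last term of the derived series not contained in `C`. With `C = C_G(V)` it acts on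
`V` as a nontrivial abelian group. -/
theorem exists_commutator_le (hG : Group.IsSolvable G) (C : Subgroup G) (hC : C ≠ ⊤) :
    ∃ N : Subgroup G, N.Normal ∧ ¬ N ≤ C ∧ ⁅N, N⁆ ≤ C := by
  classical
  have h : ∃ n, derivedSeries G n ≤ C := by
    obtain ⟨n, hn⟩ := hG.solvable
    exact ⟨n, hn ▸ bot_le⟩
  obtain ⟨n, hn⟩ : ∃ n, Nat.find h = n + 1 := by
    refine Nat.exists_eq_succ_of_ne_zero fun h0 => ?_
    have := Nat.find_spec h
    rw [h0, derivedSeries_zero] at this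
    exact hC (top_le_iff.1 this)
  refine ⟨derivedSeries G n, inferInstance, Nat.find_min h (by omega), ?_⟩
  have := Nat.find_spec h
  rwa [hn, derivedSeries_succ] at this

theorem exists_prime_nsmul_eq_zero [Finite V] (hV : IsIrreducibleModule G V) :
    ∃ p : ℕ, p.Prime ∧ p ∣ Nat.card V ∧ ∀ v : V, p • v = 0 := by
  have := hV.1
  obtain ⟨p, hp, hpV⟩ := Nat.exists_prime_and_dvd (Finite.one_lt_card (α := V)).ne'
  have := Fact.mk hp
  obtain ⟨x, hx⟩ := exists_prime_addOrderOf_dvd_card' p hpV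
  refine ⟨p, hp, hpV, ?_⟩
  let U : AddSubgroup V :=
    { carrier := {v | p • v = 0}
      add_mem' := fun {a b} ha hb => by
        simp only [Set.mem_ofPred_eq] at *
        rw [smul_add, ha, hb, add_zero]
      zero_mem' := smul_zero _
      neg_mem' := fun {a} ha => by
        simp only [Set.mem_ofPred_eq] at *
        rw [smul_neg, ha, neg_zero] }
  rcases hV.2 U (fun g v (hv : p • v = 0) => by
      change p • (g • v) = 0
      rw [smul_comm, hv, smul_zero]) with hU | hU
  · have hxU : x ∈ U := by
      change p • x = 0
      rw [← hx, addOrderOf_nsmul_eq_zero]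
    rw [hU, AddSubgroup.mem_bot] at hxU
    rw [hxU, addOrderOf_zero] at hx
    exact (hp.one_lt.ne hx).elim
  · intro v
    have : v ∈ U := hU ▸ AddSubgroup.mem_top v
    exact this

theorem mem_cen_iff_toPermHom {g : G} : g ∈ cen G V ↔ MulAction.toPermHom G V g = 1 := by
  rw [mem_cen, Equiv.ext_iff]
  rfl

/-- The elements of `N` acting with order dividing `p` form a normal subgroup acting as a `p`-group.
It fixes a nonzero vector, so by irreducibility it acts trivially. -/
theorem not_dvd_card_map [Finite V] (hV : IsIrreducibleModule G V) {p : ℕ} (hp : p.Prime)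
    (hpV : p ∣ Nat.card V) (N : Subgroup G) [hN : N.Normal] (hNC : ⁅N, N⁆ ≤ cen G V) :
    ¬ p ∣ Nat.card (N.map (MulAction.toPermHom G V)) := by
  have := Fact.mk hp
  set φ := MulAction.toPermHom G V with hφ
  have hcomm : ∀ a ∈ N, ∀ b ∈ N, Commute (φ a) (φ b) := fun a ha b hb => by
    have h1 : φ (a * b * a⁻¹ * b⁻¹) = 1 :=
      mem_cen_iff_toPermHom.1 (hNC (Subgroup.commutator_mem_commutator ha hb))
    rw [map_mul, map_mul, map_mul, map_inv, map_inv, mul_inv_eq_one, mul_inv_eq_iff_eq_mul] at h1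
    exact h1
  let P : Subgroup G :=
    { carrier := {n | n ∈ N ∧ φ n ^ p = 1}
      mul_mem' := fun {a b} ha hb => ⟨mul_mem ha.1 hb.1, by
        rw [map_mul, (hcomm a ha.1 b hb.1).mul_pow, ha.2, hb.2, one_mul]⟩
      one_mem' := ⟨one_mem _, by simp⟩
      inv_mem' := fun {a} ha => ⟨inv_mem ha.1, by rw [map_inv, inv_pow, ha.2, inv_one]⟩ }
  have hPn : P.Normal := ⟨fun n hn g => ⟨hN.conj_mem n hn.1 g, by
    rw [map_mul, map_mul, map_inv, conj_pow, hn.2, mul_one, mul_inv_cancel]⟩⟩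
  have hPp : IsPGroup p (P.map φ) := by
    rintro ⟨_, n, hn, rfl⟩
    exact ⟨1, Subtype.ext (by simpa using hn.2)⟩
  obtain ⟨b, hb, hb0⟩ := hPp.exists_fixed_point_of_prime_dvd_card_of_fixed_point V hpV
    (a := 0) (by rintro ⟨_, n, -, rfl⟩; exact smul_zero n)
  have hPC : P ≤ cen G V := le_cen_of_fixed hV P (Ne.symm hb0) fun n hn =>
    hb ⟨φ n, n, hn, rfl⟩
  intro hdvd
  obtain ⟨⟨x, hxN⟩, hx⟩ := exists_prime_orderOf_dvd_card' p hdvd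
  rw [Subgroup.orderOf_mk] at hx
  obtain ⟨n, hn, rfl⟩ := hxN
  have h1 : φ n = 1 := mem_cen_iff_toPermHom.1 (hPC ⟨hn, by rw [← hx, pow_orderOf_eq_one]⟩)
  rw [h1, orderOf_one] at hx
  exact hp.one_lt.ne hx

/-- Averaging: `d` factors through the action on `V`, and the order of the image of `N` is
invertible modulo the exponent `p` of `V`. -/
theorem exists_eq_inner_on [Finite V] (d : der G V) (hd : cen G V ≤ zeros d) (N : Subgroup G)
    {p : ℕ} (hp : p.Prime) (hpV : ∀ v : V, p • v = 0)
    (hN : ¬ p ∣ Nat.card (N.map (MulAction.toPermHom G V))) :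
    ∃ w : V, ∀ n ∈ N, d.1 n = n • w - w := by
  classical
  set φ := MulAction.toPermHom G V with hφ
  have hdφ : ∀ g h : G, φ g = φ h → d.1 g = d.1 h := fun g h hgh => by
    refine inv_mul_mem_zeros.1 (hd (mem_cen_iff_toPermHom.2 ?_))
    rw [map_mul, map_inv, ← hφ, hgh, inv_mul_cancel]
  have hpre : ∀ a : N.map φ, ∃ n : G, φ n = a.1 := fun ⟨_, n, _, h⟩ => ⟨n, h⟩
  choose q hq using hpre
  have := Fintype.ofFinite (N.map φ)
  set S : V := ∑ a, d.1 (q a) with hS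
  set m := Nat.card (N.map φ) with hm
  have key : ∀ n ∈ N, S = m • d.1 n + n • S := fun n hn => by
    let x : N.map φ := ⟨φ n, n, hn, rfl⟩
    have h1 : ∀ a, d.1 (q (x * a)) = d.1 n + n • d.1 (q a) := fun a => by
      rw [← der_mul]
      apply hdφ
      rw [hq, map_mul, hq]
      rfl
    calc S = ∑ a, d.1 (q (x * a)) := (Equiv.sum_comp (Equiv.mulLeft x) fun a => d.1 (q a)).symm
      _ = m • d.1 n + n • S := by
        simp only [h1, Finset.sum_add_distrib, Finset.sum_const, Finset.card_univ, hS,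
          Finset.smul_sum, hm, Nat.card_eq_fintype_card]
  have hcop : (m : ℤ).gcd p = 1 := by
    rw [Int.gcd_natCast_natCast]
    exact ((Nat.Prime.coprime_iff_not_dvd hp).2 hN).symm
  obtain ⟨a, b, hab⟩ := Int.isCoprime_iff_gcd_eq_one.2 hcop
  refine ⟨-(a • S), fun n hn => ?_⟩
  have h1 : (m : ℤ) • d.1 n = S - n • S := by
    rw [natCast_zsmul]
    exact eq_sub_of_add_eq (key n hn).symm
  have h2 : (p : ℤ) • d.1 n = 0 := by rw [natCast_zsmul, hpV]
  calc d.1 n = (a * m + b * p) • d.1 n := by rw [hab, one_smul]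
    _ = a • (S - n • S) := by rw [add_smul, mul_smul, mul_smul, h1, h2, smul_zero, add_zero]
    _ = n • -(a • S) - -(a • S) := by
      rw [smul_neg, smul_sub, smul_comm n a S]; abel

/-- Vanishing of the first cohomology of a solvable linear group on an irreducible module. -/
theorem exists_eq_inner (hG : Group.IsSolvable G) [Finite V] (hV : IsIrreducibleModule G V)
    (d : der G V) (hd : cen G V ≤ zeros d) : ∃ w : V, d = inner w := by
  by_cases hC : cen G V = ⊤
  · refine ⟨0, Subtype.ext (funext fun g => ?_)⟩
    rw [inner_apply, smul_zero, sub_zero]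
    exact hd (hC ▸ Subgroup.mem_top g)
  obtain ⟨N, hNn, hN, hNC⟩ := exists_commutator_le hG _ hC
  obtain ⟨p, hp, hpV, hpz⟩ := exists_prime_nsmul_eq_zero hV
  obtain ⟨w, hw⟩ := exists_eq_inner_on d hd N hp hpz (not_dvd_card_map hV hp hpV N hNC)
  refine ⟨w, ?_⟩
  have hz : ∀ n ∈ N, (d - inner w).1 n = 0 := fun n hn => by
    simp [hw n hn]
  rw [← sub_eq_zero]
  refine Subtype.ext (funext fun g => ?_)
  by_contra hne
  refine hN (le_cen_of_fixed hV N hne fun n hn => ?_)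
  -- Expanding `n * g = g * (g⁻¹ * n * g)` in both ways shows that every value of `d - inner w` is
  -- fixed by `N`.
  have h1 := der_mul (d - inner w) n g
  have h2 := der_mul (d - inner w) g (g⁻¹ * n * g)
  have h3 : g * (g⁻¹ * n * g) = n * g := by group
  have h4 : g⁻¹ * n * g ∈ N := by simpa using hNn.conj_mem n hn g⁻¹
  rw [hz n hn, zero_add] at h1
  rw [h3, hz _ h4, smul_zero, add_zero] at h2
  exact h1.symm.trans h2

/-- By Schur's lemma `End_G(V)` is a finite domain, hence a division ring, so the rank bound yields
an actual basis. -/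
theorem exists_finset_span [Finite V] (hV : IsIrreducibleModule G V) {γ : ℕ}
    (W : Submodule (EndG G V) V) (hW : Module.rank (EndG G V) W ≤ (γ : Cardinal)) :
    ∃ B : Finset V, B.card ≤ γ ∧ Submodule.span (EndG G V) (B : Set V) = W := by
  classical
  have hnt := hV.1
  have : Finite (AddMonoid.End V) := DFunLike.finite (AddMonoid.End V)
  have : Nontrivial (EndG G V) := by
    refine ⟨0, 1, fun h => ?_⟩
    obtain ⟨v, hv⟩ := exists_ne (0 : V)
    apply hv
    rw [← one_smul (EndG G V) v, ← h, zero_smul]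
  have hinj : ∀ f : EndG G V, f ≠ 0 → ∀ v : V, f • v = 0 → v = 0 := fun f hf v hv => by
    let U : AddSubgroup V := AddMonoidHom.ker (f.1 : V →+ V)
    rcases hV.2 U (fun g x (hx : f • x = 0) => by
        change f • (g • x) = 0
        rw [endG_smul_comm, hx, smul_zero]) with hU | hU
    · have : v ∈ U := hv
      rwa [hU] at this
    · refine (hf (Subtype.ext (AddMonoidHom.ext fun x => ?_))).elim
      have : x ∈ U := hU ▸ AddSubgroup.mem_top x
      exact this
  have : NoZeroDivisors (EndG G V) := ⟨fun {a b} hab => by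
    by_contra! h
    refine h.2 (Subtype.ext (AddMonoidHom.ext fun x => ?_))
    apply hinj a h.1
    change a • (b • x) = 0
    rw [← mul_smul, hab, zero_smul]⟩
  have : IsDomain (EndG G V) := NoZeroDivisors.to_isDomain _
  have := Fintype.ofFinite (EndG G V)
  let : DivisionRing (EndG G V) := Fintype.divisionRingOfIsDomain _
  have hfin : Module.Finite (EndG G V) W := Module.Finite.of_finite
  let b := Module.finBasis (EndG G V) W
  refine ⟨Finset.univ.image fun i => (b i : V), ?_, ?_⟩
  · refine Finset.card_image_le.trans ?_
    rw [Finset.card_univ, Fintype.card_fin]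
    exact Module.finrank_le_of_rank_le hW
  · rw [Finset.coe_image, Finset.coe_univ, Set.image_univ]
    have := congrArg (Submodule.map W.subtype) b.span_eq
    rw [Submodule.map_span, Submodule.map_subtype_top, ← Set.range_comp] at this
    exact this

variable (V) in
/-- The common zeros of all derivations to `V` that vanish on `H`. -/
def commonZeros (H : Subgroup G) : Subgroup G :=
  ⨅ d ∈ {d : der G V | H ≤ zeros d}, zeros d

theorem commonZeros_le {H : Subgroup G} {d : der G V} (hd : H ≤ zeros d) :
    commonZeros V H ≤ zeros d :=
  iInf₂_le d hd

variable (V) in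
/-- The fixed points of a subgroup, as an `End_G(V)`-subspace. -/
def fixedSpace (H : Subgroup G) : Submodule (EndG G V) V where
  carrier := {v | ∀ h ∈ H, h • v = v}
  add_mem' {a b} ha hb h hh := by rw [smul_add, ha h hh, hb h hh]
  zero_mem' h _ := smul_zero h
  smul_mem' f v hv h hh := by rw [← endG_smul_comm, hv h hh]

/-- The local step. The maximal subgroups above `C_G(V)` are left as a hypothesis on `I`, to be
discharged by the global induction. -/
theorem exists_coatoms (hG : Group.IsSolvable G) [Finite G] [Finite V]
    (hV : IsIrreducibleModule G V) {γ : ℕ} (hγ : IsGammaModule G V γ) (H : Subgroup G)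
    {d₀ : der G V} (hH : H ≤ zeros d₀) (hd₀ : ¬ cen G V ≤ zeros d₀) :
    ∃ T : Finset (Subgroup G), (∀ M ∈ T, IsCoatom M ∧ H ≤ M) ∧
      ∏ M ∈ T, M.index ≤ ((commonZeros V H).relIndex (cen G V)) ^ (γ + 1) ∧
      ∀ I : Subgroup G, (∀ M ∈ T, I ≤ M) →
        (∀ M, IsCoatom M → cen G V ≤ M → H ≤ M → I ≤ M) →
        ∀ d : der G V, H ≤ zeros d → I ≤ zeros d := by
  classical
  have hVn := hV.1
  have : Finite (der G V) := inferInstance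
  set D : Finset (der G V) := (Set.toFinite {d : der G V | H ≤ zeros d}).toFinset with hD
  have hDmem : ∀ d, d ∈ D ↔ H ≤ zeros d := fun d => by simp [hD]
  have hDinf : (⨅ d ∈ D, zeros d) = commonZeros V H := by
    simp only [commonZeros, hDmem, Set.mem_ofPred_eq]
  obtain ⟨t, htD, hne, heq, hcard⟩ := exists_subset_relIndex hV (cen G V) le_rfl D
  have htH : ∀ d ∈ t, H ≤ zeros d := fun d hd => (hDmem d).1 (htD hd)
  have hYz : ∀ d, H ≤ zeros d → cen G V ⊓ (⨅ d ∈ t, zeros d) ≤ zeros d := fun d hd => by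
    rw [heq, hDinf]
    exact inf_le_right.trans (commonZeros_le hd)
  have hrel : (commonZeros V H).relIndex (cen G V) = Nat.card V ^ t.card := by
    rw [← hcard, ← hDinf, ← Subgroup.inf_relIndex_left, ← heq, Subgroup.inf_relIndex_left]
  obtain ⟨d₁, hd₁⟩ : t.Nonempty := by
    rw [Finset.nonempty_iff_ne_empty]
    rintro rfl
    exact hd₀ (by simpa using hYz d₀ hH)
  obtain ⟨W', hW', hfix⟩ := hγ (fixedSpace V H)
  obtain ⟨B, hB, hBspan⟩ := exists_finset_span hV W' hW'
  have hHW : H ≤ fixingSubgroup G (fixedSpace V H : Set V) := fun h hh => by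
    rw [mem_fixingSubgroup_iff]
    exact fun v hv => hv h hh
  have hHB : ∀ w ∈ B, H ≤ zeros (inner w : der G V) := fun w hw h hh => by
    rw [mem_zeros_inner]
    have h1 := hHW hh
    rw [hfix] at h1
    have h2 := (mem_fixingSubgroup_iff G).1 h1.1
    exact h2 w (hBspan ▸ Submodule.subset_span hw)
  have hd₁w : ∀ w : V, ¬ cen G V ≤ zeros (d₁ + inner w) := fun w h => by
    refine hne d₁ hd₁ fun c hc => ?_
    have h1 := h hc
    rw [mem_zeros] at h1 ⊢
    simpa [mem_cen.1 hc w] using h1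
  -- The stabilizer of `w` contains `C_G(V)` and need not be maximal. Shifting by `d₁` makes the
  -- zero set maximal, and intersecting it with `zeros d₁` recovers the condition that `w` is fixed.
  set T : Finset (Subgroup G) := t.image zeros ∪ B.image fun w => zeros (d₁ + inner w) with hT
  have hTz : ∀ M ∈ T, ∃ d : der G V, M = zeros d ∧ H ≤ zeros d ∧ ¬ cen G V ≤ zeros d := by
    intro M hM
    rw [hT, Finset.mem_union, Finset.mem_image, Finset.mem_image] at hM
    rcases hM with ⟨d, hd, rfl⟩ | ⟨w, hw, rfl⟩
    · exact ⟨d, rfl, htH d hd, hne d hd⟩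
    · refine ⟨_, rfl, fun h hh => ?_, hd₁w w⟩
      have h1 := htH d₁ hd₁ hh
      have h2 := hHB w hw hh
      rw [mem_zeros] at h1 h2 ⊢
      rw [Submodule.coe_add, Pi.add_apply, h1, h2, add_zero]
  refine ⟨T, fun M hM => ?_, ?_, fun I hIT hIM => ?_⟩
  · obtain ⟨d, rfl, h1, h2⟩ := hTz M hM
    exact ⟨isCoatom_zeros hV d h2, h1⟩
  · have h1 : ∏ M ∈ T, M.index = Nat.card V ^ T.card := by
      rw [← Finset.prod_const]
      refine Finset.prod_congr rfl fun M hM => ?_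
      obtain ⟨d, rfl, -, h2⟩ := hTz M hM
      exact index_zeros hV d h2
    rw [h1, hrel, ← pow_mul]
    refine Nat.pow_le_pow_right Nat.card_pos ?_
    have h2 : T.card ≤ t.card + B.card :=
      (Finset.card_union_le _ _).trans (add_le_add Finset.card_image_le Finset.card_image_le)
    have h3 : 1 ≤ t.card := Finset.card_pos.2 ⟨d₁, hd₁⟩
    -- `t.card + γ ≤ t.card * (γ + 1)`, because `t` is nonempty.
    nlinarith
  · have hIt : ∀ d ∈ t, I ≤ zeros d := fun d hd => hIT _ (by
      rw [hT, Finset.mem_union, Finset.mem_image]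
      exact Or.inl ⟨d, hd, rfl⟩)
    have hIB : ∀ g ∈ I, ∀ w ∈ B, g • w = w := fun g hg w hw => by
      have h1 := hIT (zeros (d₁ + inner w)) (by
        rw [hT, Finset.mem_union, Finset.mem_image, Finset.mem_image]
        exact Or.inr ⟨w, hw, rfl⟩) hg
      have h2 := hIt d₁ hd₁ hg
      rw [mem_zeros] at h1 h2
      rw [Submodule.coe_add, Pi.add_apply, h2, zero_add] at h1
      exact mem_zeros_inner.1 h1
    have hIW' : I ≤ fixingSubgroup G (W' : Set V) := fun g hg => by
      rw [mem_fixingSubgroup_iff, ← hBspan]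
      intro v hv
      refine Submodule.span_induction (p := fun v _ => g • v = v) (fun w hw => hIB g hg w hw)
        (smul_zero g) (fun x y _ _ hx hy => by rw [smul_add, hx, hy])
        (fun a x _ hx => by rw [← endG_smul_comm, hx]) hv
    have hIW : I ≤ fixingSubgroup G (fixedSpace V H : Set V) := by
      rw [hfix]
      -- A maximal subgroup containing `C_G(W)` contains both `C_G(V)` and `H`, so the hypothesis on
      -- `I` applies to it.
      refine le_inf hIW' (le_sInf fun M hM => hIM M hM.1 ?_ (hHW.trans hM.2))
      refine le_trans (fun c hc => ?_) hM.2
      rw [mem_fixingSubgroup_iff]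
      exact fun v _ => mem_cen.1 hc v
    intro d hd
    obtain ⟨d', hd', hdd'⟩ := exists_mem_span hV t (cen G V) le_rfl d (hYz d hd)
    obtain ⟨w, hw⟩ := exists_eq_inner hG hV (d - d') fun c hc => by
      rw [mem_zeros]
      simp [hdd' c hc]
    have hwW : w ∈ fixedSpace V H := fun h hh => by
      rw [← mem_zeros_inner, ← hw, mem_zeros]
      have h1 := hd hh
      have h2 := le_zeros_of_mem_span (s := (t : Set (der G V))) htH hd' hh
      rw [mem_zeros] at h1 h2
      simp [h1, h2]
    intro g hg
    have h2 := le_zeros_of_mem_span (s := (t : Set (der G V))) hIt hd' hg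
    have h3 : g ∈ zeros (d - d') := by
      rw [hw, mem_zeros_inner]
      exact (mem_fixingSubgroup_iff G).1 (hIW hg) w hwW
    rw [mem_zeros] at h2 h3 ⊢
    simpa [h2] using h3

end Local

/-! ### Bounding the product of the local indices by the index of `H`. -/

section Counting

variable {G : Type u} [Group G] {V : Type v} [AddCommGroup V] [DistribMulAction G V]

theorem exists_maximal_normal_lt [Finite G] (hG : Group.IsSolvable G) (N : Subgroup G)
    [hN : N.Normal] (hne : N ≠ ⊥) :
    ∃ L : Subgroup G, L.Normal ∧ L < N ∧ ⁅N, N⁆ ≤ L ∧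
      ∀ K : Subgroup G, K.Normal → L ≤ K → K < N → K = L := by
  have hlt : ⁅N, N⁆ < N := by
    have := hG
    exact Group.IsSolvable.commutator_lt_of_ne_bot hne
  obtain ⟨L, hL⟩ := (Set.toFinite {L : Subgroup G | L.Normal ∧ L < N ∧ ⁅N, N⁆ ≤ L}).exists_maximal
    ⟨⁅N, N⁆, Subgroup.commutator_normal N N, hlt, le_rfl⟩
  exact ⟨L, hL.prop.1, hL.prop.2.1, hL.prop.2.2, fun K hK hLK hKN =>
    le_antisymm (hL.2 ⟨hK, hKN, hL.prop.2.2.trans hLK⟩ hLK) hLK⟩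

/-- For `c ∈ N ⊓ cen G V` with `d c ≠ 0` and `n ∈ N`, the commutator of `n` and `c` lies in `L ⊓ cen
G V`, so `n` fixes `d c`. Hence `N` centralizes `V`, and `N ⊓ zeros d` is a proper normal subgroup
of `N` above `L`. -/
theorem le_cen_and_inf_zeros_eq (hV : IsIrreducibleModule G V) {N L : Subgroup G} [hN : N.Normal]
    (hLN : L < N) (hNL : ⁅N, N⁆ ≤ L)
    (hmax : ∀ K : Subgroup G, K.Normal → L ≤ K → K < N → K = L)
    {d : der G V} (hL : L ⊓ cen G V ≤ zeros d) (hd : ¬ N ⊓ cen G V ≤ zeros d) :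
    N ≤ cen G V ∧ N ⊓ zeros d = L := by
  obtain ⟨c, hc, hcd⟩ := SetLike.not_le_iff_exists.1 hd
  have hNC : N ≤ cen G V := by
    refine le_cen_of_fixed hV N (v := d.1 c) hcd fun n hn => ?_
    have h1 : n * c * n⁻¹ * c⁻¹ ∈ L := hNL (Subgroup.commutator_mem_commutator hn hc.1)
    have h2 : n * c * n⁻¹ * c⁻¹ ∈ cen G V :=
      mul_mem (cen_normal.conj_mem c hc.2 n) (inv_mem hc.2)
    have h3 : d.1 (n * c * n⁻¹ * c⁻¹) = 0 := hL ⟨h1, h2⟩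
    rw [der_mul_of_mem_cen d (cen_normal.conj_mem c hc.2 n), der_conj d hc.2, der_inv,
      mem_cen.1 (inv_mem hc.2), add_neg_eq_zero] at h3
    exact h3
  refine ⟨hNC, hmax _ (inf_zeros_normal d N hNC) (le_inf hLN.le fun x hx => ?_) ?_⟩
  · exact hL ⟨hx, hNC (hLN.le hx)⟩
  · exact inf_lt_left.2 fun h => hd (inf_le_left.trans h)

/-- A basis `t` on `K` also works on `K'`: a derivation vanishing on `H` differs from a combination
of `t` by one vanishing on `H` and `K`, hence on `K'`. So the exponent of `|V|` for `K'` is at most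
`t.card`. -/
theorem relIndex_commonZeros_le [Finite G] [Finite V] (hV : IsIrreducibleModule G V)
    (H K K' : Subgroup G) [K.Normal] [K'.Normal] (hK : K ≤ cen G V) (hK' : K' ≤ cen G V)
    (h : ∀ d : der G V, H ≤ zeros d → K ≤ zeros d → K' ≤ zeros d) :
    (commonZeros V H).relIndex K' ≤ (commonZeros V H).relIndex K := by
  classical
  set D : Finset (der G V) := (Set.toFinite {d : der G V | H ≤ zeros d}).toFinset with hD
  have hDmem : ∀ d, d ∈ D ↔ H ≤ zeros d := fun d => by simp [hD]
  have hDinf : (⨅ d ∈ D, zeros d) = commonZeros V H := by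
    simp only [commonZeros, hDmem, Set.mem_ofPred_eq]
  have hVn := hV.1
  obtain ⟨t, htD, -, heq, hcard⟩ := exists_subset_relIndex hV K hK D
  have htH : ∀ d ∈ t, H ≤ zeros d := fun d hd => (hDmem d).1 (htD hd)
  have hYz : ∀ d, H ≤ zeros d → K' ⊓ (⨅ d ∈ t, zeros d) ≤ zeros d := fun d hd => by
    obtain ⟨d', hd', hdd'⟩ := exists_mem_span hV t K hK d (by
      rw [heq, hDinf]
      exact inf_le_right.trans (commonZeros_le hd))
    have h1 : H ≤ zeros (d - d') := fun x hx => by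
      have h1 := hd hx
      have h2 := le_zeros_of_mem_span (s := (t : Set (der G V))) htH hd' hx
      rw [mem_zeros] at h1 h2 ⊢
      simp [h1, h2]
    have h2 := h _ h1 fun k hk => by
      rw [mem_zeros]
      simp [hdd' k hk]
    intro x hx
    have h3 := h2 hx.1
    have h4 := le_zeros_of_mem_span (s := (t : Set (der G V))) (I := K' ⊓ ⨅ d ∈ t, zeros d)
      (fun d hd => inf_le_right.trans (iInf₂_le d hd)) hd' hx
    rw [mem_zeros] at h3 h4 ⊢
    simpa [h4] using h3
  have heq' : K' ⊓ (⨅ d ∈ t, zeros d) = K' ⊓ commonZeros V H :=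
    le_antisymm (le_inf inf_le_left (le_iInf₂ fun d hd => hYz d hd))
      (inf_le_inf_left _ (le_iInf₂ fun d hd => commonZeros_le (htH d hd)))
  obtain ⟨t', ht't, -, ht'eq, ht'card⟩ := exists_subset_relIndex hV K' hK' t
  have e1 : (commonZeros V H).relIndex K = Nat.card V ^ t.card := by
    rw [← hcard, ← hDinf, ← Subgroup.inf_relIndex_left, ← heq, Subgroup.inf_relIndex_left]
  have e2 : (commonZeros V H).relIndex K' = Nat.card V ^ t'.card := by
    rw [← ht'card, ← Subgroup.inf_relIndex_left, ← heq', ← ht'eq, Subgroup.inf_relIndex_left]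
  rw [e1, e2]
  exact Nat.pow_le_pow_right Nat.card_pos (Finset.card_le_card ht't)

/-- Both modules are the quotient of `N` by the same kernel; the isomorphism is `d n ↦ d' n`. -/
theorem exists_equiv_of_inf_zeros_eq {V' : Type v} [AddCommGroup V'] [DistribMulAction G V']
    (hV : IsIrreducibleModule G V) (hV' : IsIrreducibleModule G V') {N : Subgroup G}
    [hN : N.Normal] (hC : N ≤ cen G V) (hC' : N ≤ cen G V') {d : der G V} {d' : der G V'}
    (hd : ¬ N ≤ zeros d) (hd' : ¬ N ≤ zeros d') (h : N ⊓ zeros d = N ⊓ zeros d') :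
    ∃ e : V ≃+ V', ∀ (g : G) (v : V), e (g • v) = g • e v := by
  choose p hpN hp using der_surjOn hV N hC d hd
  have key : ∀ a ∈ N, ∀ b ∈ N, (d.1 a = d.1 b ↔ d'.1 a = d'.1 b) := fun a ha b hb => by
    have hab : a⁻¹ * b ∈ N := mul_mem (inv_mem ha) hb
    have := SetLike.ext_iff.1 h (a⁻¹ * b)
    rw [Subgroup.mem_inf, Subgroup.mem_inf] at this
    rw [← inv_mul_mem_zeros, ← inv_mul_mem_zeros]
    simpa [hab] using this
  let f : V →+ V' := AddMonoidHom.mk' (fun v => d'.1 (p v)) fun v w => by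
    rw [← der_mul_of_mem_cen d' (hC' (hpN v)), ← key _ (hpN _) _ (mul_mem (hpN v) (hpN w)),
      der_mul_of_mem_cen d (hC (hpN v)), hp, hp, hp]
  refine ⟨AddEquiv.ofBijective f ⟨fun v w hvw => ?_, fun v' => ?_⟩, fun g v => ?_⟩
  · have := (key _ (hpN v) _ (hpN w)).2 hvw
    rwa [hp, hp] at this
  · obtain ⟨n, hn, hnv⟩ := der_surjOn hV' N hC' d' hd' v'
    refine ⟨d.1 n, ?_⟩
    change d'.1 (p (d.1 n)) = v'
    rw [← hnv, ← key _ (hpN _) _ hn, hp]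
  · change d'.1 (p (g • v)) = g • d'.1 (p v)
    rw [← der_conj d' (hC' (hpN v)), ← key _ (hpN _) _ (hN.conj_mem _ (hpN v) g), hp,
      der_conj d (hC (hpN v)), hp]

/-- Induction up a chief series. Passing from `L` to `N` can increase the factor of `W i` only if
some derivation into `W i` vanishing on `H` has kernel exactly `L` on `N`. Then `W i` is determined
by `N/L`, so only one factor grows, by at most `|N : L|`. -/
theorem prod_relIndex_commonZeros_le [Finite G] (hG : Group.IsSolvable G) {ι : Type*} [Fintype ι]
    (W : ι → Type v) [∀ i, AddCommGroup (W i)] [∀ i, DistribMulAction G (W i)]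
    [∀ i, Finite (W i)] (hW : ∀ i, IsIrreducibleModule G (W i))
    (hiso : ∀ i j (e : W i ≃+ W j), (∀ (g : G) (v : W i), e (g • v) = g • e v) → i = j)
    (H : Subgroup G) (N : Subgroup G) [hN : N.Normal] :
    ∏ i, (commonZeros (W i) H).relIndex (N ⊓ cen G (W i)) ≤ H.relIndex N := by
  classical
  revert hN
  induction N using WellFoundedLT.induction with
  | ind N ih =>
  intro hN
  by_cases hne : N = ⊥
  · subst hne
    simp
  obtain ⟨L, hLn, hLN, hNL, hmax⟩ := exists_maximal_normal_lt hG N hne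
  have ihL := ih L hLN
  have hpos : ∀ K K' : Subgroup G, K.relIndex K' ≠ 0 := fun K K' => Subgroup.index_ne_zero_of_finite
  have hno : ∀ i, (∀ d : der G (W i), H ≤ zeros d → L ⊓ cen G (W i) ≤ zeros d →
      N ⊓ cen G (W i) ≤ zeros d) → (commonZeros (W i) H).relIndex (N ⊓ cen G (W i)) ≤
      (commonZeros (W i) H).relIndex (L ⊓ cen G (W i)) := fun i h =>
    relIndex_commonZeros_le (hW i) H _ _ inf_le_right inf_le_right h
  by_cases hjump : ∃ i, ∃ d : der G (W i), H ≤ zeros d ∧ L ⊓ cen G (W i) ≤ zeros d ∧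
      ¬ N ⊓ cen G (W i) ≤ zeros d
  · obtain ⟨i, d, hHd, hLd, hNd⟩ := hjump
    obtain ⟨hNC, hNdL⟩ := le_cen_and_inf_zeros_eq (hW i) hLN hNL hmax hLd hNd
    have hNd' : ¬ N ≤ zeros d := fun h => hNd (inf_le_left.trans h)
    have hother : ∀ j, j ≠ i → (commonZeros (W j) H).relIndex (N ⊓ cen G (W j)) ≤
        (commonZeros (W j) H).relIndex (L ⊓ cen G (W j)) := fun j hj => by
      refine hno j fun d' hHd' hLd' => ?_
      by_contra hNd'
      obtain ⟨hNC', hNdL'⟩ := le_cen_and_inf_zeros_eq (hW j) hLN hNL hmax hLd' hNd'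
      obtain ⟨e, he⟩ := exists_equiv_of_inf_zeros_eq (hW j) (hW i) hNC' hNC
        (fun h => hNd' (inf_le_left.trans h)) (fun h => hNd (inf_le_left.trans h))
        (hNdL'.trans hNdL.symm)
      exact hj (hiso j i e he)
    have hi : (commonZeros (W i) H).relIndex (N ⊓ cen G (W i)) ≤
        (commonZeros (W i) H).relIndex (L ⊓ cen G (W i)) * L.relIndex N := by
      rw [inf_eq_left.2 hNC, inf_eq_left.2 (hLN.le.trans hNC),
        ← Subgroup.inf_relIndex_right _ L, Subgroup.relIndex_mul_relIndex _ _ _ inf_le_right hLN.le]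
      exact Subgroup.relIndex_le_of_le_left inf_le_left (hpos _ _)
    -- The right side grows by all of `|N : L|`: since `d` vanishes on `H`, `H ⊓ N ≤ N ⊓ zeros d =
    -- L`.
    have hHN : H.relIndex N = H.relIndex L * L.relIndex N := by
      rw [← Subgroup.inf_relIndex_right _ L,
        Subgroup.relIndex_mul_relIndex _ _ _ inf_le_right hLN.le, ← Subgroup.inf_relIndex_right]
      congr 1
      refine le_antisymm (le_inf inf_le_left ?_) (inf_le_inf_left _ hLN.le)
      rw [← hNdL]
      exact le_inf inf_le_right (inf_le_left.trans hHd)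
    calc _ = (commonZeros (W i) H).relIndex (N ⊓ cen G (W i)) *
          ∏ j ∈ Finset.univ.erase i, (commonZeros (W j) H).relIndex (N ⊓ cen G (W j)) :=
          (Finset.mul_prod_erase _ _ (Finset.mem_univ i)).symm
      _ ≤ (commonZeros (W i) H).relIndex (L ⊓ cen G (W i)) * L.relIndex N *
          ∏ j ∈ Finset.univ.erase i, (commonZeros (W j) H).relIndex (L ⊓ cen G (W j)) :=
          Nat.mul_le_mul hi (Finset.prod_le_prod' fun j hj => hother j (Finset.ne_of_mem_erase hj))
      _ = (∏ j, (commonZeros (W j) H).relIndex (L ⊓ cen G (W j))) * L.relIndex N := by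
          rw [← Finset.mul_prod_erase _ _ (Finset.mem_univ i)]; ring
      _ ≤ H.relIndex N := by
          rw [hHN]
          exact Nat.mul_le_mul_right _ ihL
  · push Not at hjump
    exact (Finset.prod_le_prod' fun i _ => hno i (hjump i)).trans
      (ihL.trans (Subgroup.relIndex_le_of_le_right hLN.le (hpos _ _)))

end Counting

/-! ### Primitive solvable groups and the chief factor attached to a maximal subgroup. -/

section Primitive

variable {G : Type u} [Group G]

theorem exists_isMinimalNormal [Finite G] [Nontrivial G] : ∃ N : Subgroup G, IsMinimalNormal N := by
  obtain ⟨N, hN⟩ := (Set.toFinite {N : Subgroup G | N.Normal ∧ N ≠ ⊥}).exists_minimal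
    ⟨⊤, inferInstance, top_ne_bot⟩
  exact ⟨N, hN.prop.1, hN.prop.2, fun K hK hKN hne => le_antisymm hKN (hN.2 ⟨hK, hne⟩ hKN)⟩

theorem IsMinimalNormal.commutator_eq_bot (hG : Group.IsSolvable G) {N : Subgroup G}
    (hN : IsMinimalNormal N) : ⁅N, N⁆ = ⊥ := by
  have := hG
  have := hN.1
  have hlt := Group.IsSolvable.commutator_lt_of_ne_bot hN.2.1
  by_contra h
  exact hlt.ne (hN.2.2 _ inferInstance hlt.le h)

/-- A core-free maximal subgroup of a finite solvable group complements the socle, which is a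
self-centralizing abelian minimal normal subgroup. -/
theorem socle_of_normalCore_eq_bot [Finite G] (hG : Group.IsSolvable G) {M : Subgroup G}
    (hM : IsCoatom M) (hcore : M.normalCore = ⊥) :
    IsMinimalNormal (socle G) ∧ ⁅socle G, socle G⁆ = ⊥ ∧ socle G ⊓ M = ⊥ ∧
      Subgroup.centralizer (socle G : Set G) ≤ socle G := by
  have : Nontrivial G := by
    by_contra h
    rw [not_nontrivial_iff_subsingleton] at h
    exact hM.1 (Subsingleton.elim _ _)
  have hnot : ∀ K : Subgroup G, K.Normal → K ≤ M → K = ⊥ := fun K hK h =>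
    le_bot_iff.1 (hcore ▸ Subgroup.normal_le_normalCore.2 h)
  obtain ⟨N, hN⟩ := exists_isMinimalNormal (G := G)
  have hNn := hN.1
  have hNN := hN.commutator_eq_bot hG
  have hcomm : ∀ a ∈ N, ∀ b ∈ N, a * b = b * a := fun a ha b hb => by
    have : a * b * a⁻¹ * b⁻¹ ∈ ⁅N, N⁆ := Subgroup.commutator_mem_commutator ha hb
    rw [hNN, Subgroup.mem_bot, mul_inv_eq_one, mul_inv_eq_iff_eq_mul] at this
    exact this
  have hsup : N ⊔ M = ⊤ := hM.2 _ (lt_of_le_of_ne le_sup_right fun h =>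
    hN.2.1 (hnot N hNn (h ▸ le_sup_left)))
  have hdec : ∀ g : G, ∃ n ∈ N, ∃ m ∈ M, n * m = g := fun g =>
    Subgroup.mem_sup_of_normal_left.1 (hsup ▸ Subgroup.mem_top g)
  -- As `G = NM`, a subgroup of `M` normalized by `M` and centralized by `N` is normal in `G`, hence
  -- trivial. This is used for `N ⊓ M` and for the centralizer of `N` in `M`.
  have htriv : ∀ K : Subgroup G, K ≤ M → (∀ m ∈ M, ∀ k ∈ K, m * k * m⁻¹ ∈ K) →
      (∀ n ∈ N, ∀ k ∈ K, n * k = k * n) → K = ⊥ := fun K hKM hMK hNK =>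
    hnot K ⟨fun k hk g => by
      obtain ⟨n, hn, m, hm, rfl⟩ := hdec g
      have h1 := hMK m hm k hk
      have h2 : n * m * k * (n * m)⁻¹ = n * (m * k * m⁻¹) * n⁻¹ := by group
      rwa [h2, hNK n hn _ h1, mul_inv_cancel_right]⟩ hKM
  have hNM : N ⊓ M = ⊥ := htriv _ inf_le_right
    (fun m hm k hk => ⟨hNn.conj_mem k hk.1 m, M.mul_mem (M.mul_mem hm hk.2) (M.inv_mem hm)⟩)
    fun n hn k hk => hcomm n hn k hk.1
  have hCM : Subgroup.centralizer (N : Set G) ⊓ M = ⊥ := htriv _ inf_le_right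
    (fun m hm k hk => Subgroup.mem_inf.2 ⟨Subgroup.Normal.conj_mem inferInstance k hk.1 m,
      M.mul_mem (M.mul_mem hm hk.2) (M.inv_mem hm)⟩)
    fun n hn k hk => Subgroup.mem_centralizer_iff.1 hk.1 n hn
  have hNC : N ≤ Subgroup.centralizer (N : Set G) := fun a ha =>
    Subgroup.mem_centralizer_iff.2 fun b hb => hcomm b hb a ha
  have hC : Subgroup.centralizer (N : Set G) ≤ N := fun c hc => by
    obtain ⟨n, hn, m, hm, rfl⟩ := hdec c
    have h1 : m ∈ Subgroup.centralizer (N : Set G) := by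
      have := mul_mem (inv_mem (hNC hn)) hc
      rwa [inv_mul_cancel_left] at this
    have h2 : m ∈ (⊥ : Subgroup G) := hCM ▸ ⟨h1, hm⟩
    rw [Subgroup.mem_bot.1 h2, mul_one]
    exact hn
  have hsoc : socle G = N := by
    refine le_antisymm (sSup_le fun N' hN' => ?_) (le_sSup hN)
    have hN'n : N'.Normal := hN'.1
    by_cases h : N' ⊓ N = ⊥
    · refine le_trans (fun a ha => Subgroup.mem_centralizer_iff.2 fun b hb => ?_) hC
      have : b * a * b⁻¹ * a⁻¹ ∈ N' ⊓ N := Subgroup.mem_inf.2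
        ⟨N'.mul_mem (hN'n.conj_mem a ha b) (N'.inv_mem ha), by
          have h1 := N.mul_mem hb (hNn.conj_mem _ (N.inv_mem hb) a)
          simpa [mul_assoc] using h1⟩
      rw [h, Subgroup.mem_bot, mul_inv_eq_one, mul_inv_eq_iff_eq_mul] at this
      exact this
    · exact inf_eq_left.1 (hN'.2.2 _ inferInstance inf_le_left h)
  rw [hsoc]
  exact ⟨hN, hNN, hNM, hC⟩

theorem isCoatom_map_mk {M : Subgroup G} (hM : IsCoatom M) :
    IsCoatom (M.map (QuotientGroup.mk' M.normalCore)) ∧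
      (M.map (QuotientGroup.mk' M.normalCore)).comap (QuotientGroup.mk' M.normalCore) = M ∧
      (M.map (QuotientGroup.mk' M.normalCore)).normalCore = ⊥ := by
  set π := QuotientGroup.mk' M.normalCore with hπ
  have hsurj : Function.Surjective π := QuotientGroup.mk'_surjective _
  have hcm : (M.map π).comap π = M := by
    rw [Subgroup.comap_map_eq_self]
    rw [hπ, QuotientGroup.ker_mk']
    exact M.normalCore_le
  refine ⟨⟨fun h => hM.1 ?_, fun K hK => ?_⟩, hcm, ?_⟩
  · rw [← hcm, h, Subgroup.comap_top]
  · have h1 : K.comap π = ⊤ := by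
      exact hM.2 _ (hcm.symm.trans_lt (Subgroup.comap_lt_comap_of_surjective hsurj |>.2 hK))
    rw [← Subgroup.map_comap_eq_self_of_surjective hsurj K, h1,
      Subgroup.map_top_of_surjective _ hsurj]
  · have h1 : ((M.map π).normalCore).comap π ≤ M.normalCore := by
      rw [Subgroup.normal_le_normalCore]
      exact (Subgroup.comap_mono (Subgroup.normalCore_le _)).trans hcm.le
    rw [eq_bot_iff, ← Subgroup.map_comap_eq_self_of_surjective hsurj (M.map π).normalCore]
    refine (Subgroup.map_mono h1).trans ?_
    rw [hπ, Subgroup.map_le_iff_le_comap, MonoidHom.comap_bot, QuotientGroup.ker_mk']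

/-- The structure of `X_M / Y_M` for a maximal subgroup `M` of a finite solvable group. -/
theorem chiefTop_structure [Finite G] (hG : Group.IsSolvable G) {M : Subgroup G}
    (hM : IsCoatom M) :
    (∀ K : Subgroup G, K.Normal → M.normalCore ≤ K → K ≤ chiefTop M →
      K = M.normalCore ∨ K = chiefTop M) ∧
    (∀ x ∈ chiefTop M, ∀ y ∈ chiefTop M, x * y * x⁻¹ * y⁻¹ ∈ M.normalCore) ∧
    chiefTop M ⊓ M = M.normalCore ∧
    (∀ g, (∀ x ∈ chiefTop M, g * x * g⁻¹ * x⁻¹ ∈ M.normalCore) → g ∈ chiefTop M) ∧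
    ¬ chiefTop M ≤ M := by
  obtain ⟨hM', hcm, hcore⟩ := isCoatom_map_mk hM
  have hG' : Group.IsSolvable (G ⧸ M.normalCore) := by
    have := hG
    infer_instance
  obtain ⟨hmin, hcomm, hinf, hcent⟩ := socle_of_normalCore_eq_bot hG' hM' hcore
  set π := QuotientGroup.mk' M.normalCore with hπ
  have hsurj : Function.Surjective π := QuotientGroup.mk'_surjective _
  have hker : ∀ g, π g = 1 ↔ g ∈ M.normalCore := fun g => QuotientGroup.eq_one_iff g
  have hmem : ∀ g, g ∈ chiefTop M ↔ π g ∈ socle (G ⧸ M.normalCore) := fun g => Iff.rfl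
  have hle : M.normalCore ≤ chiefTop M := fun g hg => by
    rw [hmem, (hker g).2 hg]
    exact one_mem _
  have hXM : chiefTop M ⊓ M = M.normalCore := by
    refine le_antisymm (fun g hg => ?_) (le_inf hle M.normalCore_le)
    rw [← hker, ← Subgroup.mem_bot, ← hinf]
    exact ⟨hg.1, Subgroup.mem_map_of_mem _ hg.2⟩
  refine ⟨fun K hK h1 h2 => ?_, fun x hx y hy => ?_, hXM, fun g hg => ?_, fun h => ?_⟩
  · have hKc : (K.map π).comap π = K := by
      rw [Subgroup.comap_map_eq_self]
      rwa [hπ, QuotientGroup.ker_mk']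
    by_cases h : K.map π = ⊥
    · left
      rw [← hKc, h, MonoidHom.comap_bot, hπ, QuotientGroup.ker_mk']
    · right
      rw [← hKc, hmin.2.2 _ (hK.map π hsurj) (Subgroup.map_le_iff_le_comap.2 h2) h]
      rfl
  · rw [← hker, ← Subgroup.mem_bot, ← hcomm, map_mul, map_mul, map_mul, map_inv, map_inv]
    exact Subgroup.commutator_mem_commutator ((hmem x).1 hx) ((hmem y).1 hy)
  · rw [hmem]
    refine hcent (Subgroup.mem_centralizer_iff.2 fun b hb => ?_)
    obtain ⟨x, rfl⟩ := hsurj b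
    have h1 := (hker _).2 (hg x ((hmem x).2 hb))
    rw [map_mul, map_mul, map_mul, map_inv, map_inv, mul_inv_eq_one, mul_inv_eq_iff_eq_mul] at h1
    exact h1.symm
  · refine hmin.2.1 ?_
    rw [inf_eq_left.2 h] at hXM
    rw [← Subgroup.map_comap_eq_self_of_surjective hsurj (socle _)]
    change (chiefTop M).map π = ⊥
    rw [hXM, eq_bot_iff, Subgroup.map_le_iff_le_comap, MonoidHom.comap_bot, hπ,
      QuotientGroup.ker_mk']

theorem exists_isoChiefFactor [Finite G] (hG : Group.IsSolvable G) {M : Subgroup G}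
    (hM : IsCoatom M) :
    ∃ (V : Type u) (_ : AddCommGroup V) (_ : DistribMulAction G V), IsoChiefFactor V M := by
  obtain ⟨-, hcomm, -⟩ := chiefTop_structure hG hM
  let : CommGroup (ChiefFactor M) :=
    { (inferInstance : Group (ChiefFactor M)) with
      mul_comm := by
        rintro ⟨x⟩ ⟨y⟩
        refine QuotientGroup.eq.2 ?_
        rw [Subgroup.mem_subgroupOf]
        have := hcomm _ (inv_mem y.2) _ (inv_mem x.2)
        simpa [mul_assoc] using this }
  have hle : ∀ g : G, M.normalCore.subgroupOf (chiefTop M) ≤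
      (M.normalCore.subgroupOf (chiefTop M)).comap
        (MulAut.conjNormal g : MulAut (chiefTop M)).toMonoidHom := fun g x hx => by
    rw [Subgroup.mem_comap, Subgroup.mem_subgroupOf]
    change ((MulAut.conjNormal g x : chiefTop M) : G) ∈ M.normalCore
    rw [MulAut.conjNormal_apply]
    exact M.normalCore_normal.conj_mem _ (Subgroup.mem_subgroupOf.1 hx) g
  let act : G → ChiefFactor M →* ChiefFactor M := fun g => QuotientGroup.map _ _ _ (hle g)
  have hact : ∀ g (x : chiefTop M), act g (QuotientGroup.mk x) =
      QuotientGroup.mk (MulAut.conjNormal g x) := fun g x => rfl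
  let : DistribMulAction G (Additive (ChiefFactor M)) :=
    { smul := fun g v => Additive.ofMul (act g v.toMul)
      one_smul := by
        rintro ⟨x⟩
        change act 1 (QuotientGroup.mk x) = QuotientGroup.mk x
        rw [hact, map_one, MulAut.one_apply]
      mul_smul := by
        rintro g h ⟨x⟩
        change act (g * h) (QuotientGroup.mk x) = act g (act h (QuotientGroup.mk x))
        rw [hact, hact, hact, map_mul, MulAut.mul_apply]
      smul_zero := fun g => map_one (act g)
      smul_add := fun g x y => map_mul (act g) x.toMul y.toMul }
  exact ⟨Additive (ChiefFactor M), inferInstance, inferInstance,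
    MulEquiv.refl _, fun g x => rfl⟩

variable {V : Type v} [AddCommGroup V] [DistribMulAction G V]

theorem IsoChiefFactor.trans_addEquiv {M : Subgroup G} (h : IsoChiefFactor V M)
    {V' : Type*} [AddCommGroup V'] [DistribMulAction G V'] (f : V ≃+ V')
    (hf : ∀ (g : G) (v : V), f (g • v) = g • f v) : IsoChiefFactor V' M := by
  obtain ⟨e, he⟩ := h
  refine ⟨e.trans (AddEquiv.toMultiplicative f), fun g x => ?_⟩
  change f (e _).toAdd = g • f (e _).toAdd
  rw [he, hf]

theorem IsoChiefFactor.finite [Finite G] {M : Subgroup G} (h : IsoChiefFactor V M) :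
    Finite V := by
  obtain ⟨e, -⟩ := h
  exact Finite.of_equiv _ (e.toEquiv.trans Multiplicative.toAdd)

theorem IsoChiefFactor.exists_map {M : Subgroup G} (h : IsoChiefFactor V M) :
    ∃ φ : chiefTop M → V, (∀ x y, φ (x * y) = φ x + φ y) ∧ (∀ v, ∃ x, φ x = v) ∧
      (∀ x, φ x = 0 ↔ (x : G) ∈ M.normalCore) ∧
      ∀ (g : G) x, φ (MulAut.conjNormal g x) = g • φ x := by
  obtain ⟨e, he⟩ := h
  refine ⟨fun x => (e (QuotientGroup.mk x)).toAdd, fun x y => ?_, fun v => ?_, fun x => ?_, he⟩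
  · exact congrArg Multiplicative.toAdd (map_mul e (QuotientGroup.mk x) (QuotientGroup.mk y))
  · obtain ⟨x, hx⟩ := QuotientGroup.mk_surjective (e.symm (Multiplicative.ofAdd v))
    exact ⟨x, by simp only [hx, e.apply_symm_apply, toAdd_ofAdd]⟩
  · rw [toAdd_eq_zero, map_eq_one_iff e e.injective, QuotientGroup.eq_one_iff,
      Subgroup.mem_subgroupOf]

theorem IsoChiefFactor.isIrreducibleModule [Finite G] (hG : Group.IsSolvable G) {M : Subgroup G}
    (hM : IsCoatom M) (h : IsoChiefFactor V M) : IsIrreducibleModule G V := by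
  obtain ⟨hchief, -, hXM, -, hnle⟩ := chiefTop_structure hG hM
  obtain ⟨φ, hmul, hsurj, hker, hconj⟩ := h.exists_map
  have hone : φ 1 = 0 := (hker 1).2 (one_mem _)
  constructor
  · obtain ⟨x, hx, hxM⟩ := SetLike.not_le_iff_exists.1 hnle
    exact ⟨φ ⟨x, hx⟩, 0, fun h0 => hxM (M.normalCore_le ((hker ⟨x, hx⟩).1 h0))⟩
  · intro U hU
    let K : Subgroup G :=
      { carrier := {g | ∃ hg : g ∈ chiefTop M, φ ⟨g, hg⟩ ∈ U}
        mul_mem' := by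
          rintro a b ⟨ha, ha'⟩ ⟨hb, hb'⟩
          exact ⟨mul_mem ha hb, by
            have := hmul ⟨a, ha⟩ ⟨b, hb⟩
            rw [MulMemClass.mk_mul_mk] at this
            rw [this]
            exact add_mem ha' hb'⟩
        one_mem' := ⟨one_mem _, by
          change φ 1 ∈ U
          rw [hone]
          exact zero_mem U⟩
        inv_mem' := by
          rintro a ⟨ha, ha'⟩
          refine ⟨inv_mem ha, ?_⟩
          have h1 := hmul ⟨a, ha⟩⁻¹ ⟨a, ha⟩
          rw [inv_mul_cancel, hone] at h1
          have h2 := eq_neg_of_add_eq_zero_left h1.symm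
          change φ ⟨a, ha⟩⁻¹ ∈ U
          rw [h2]
          exact neg_mem ha' }
    have hKn : K.Normal := by
      refine ⟨?_⟩
      rintro n ⟨hn, hn'⟩ g
      refine ⟨(chiefTop_normal M).conj_mem n hn g, ?_⟩
      have h1 := hU g _ hn'
      rw [← hconj] at h1
      convert h1 using 2
      exact Subtype.ext (MulAut.conjNormal_apply g ⟨n, hn⟩).symm
    rcases hchief K hKn (fun g hg => by
        have hgX : g ∈ chiefTop M := by
          rw [← hXM] at hg
          exact hg.1
        refine ⟨hgX, ?_⟩
        rw [(hker ⟨g, hgX⟩).2 hg]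
        exact zero_mem U) (fun g hg => hg.1) with hK | hK
    · left
      rw [eq_bot_iff]
      intro u hu
      obtain ⟨x, rfl⟩ := hsurj u
      have hxK : (x : G) ∈ K := ⟨x.2, hu⟩
      rw [hK, ← hker] at hxK
      exact hxK
    · right
      rw [eq_top_iff]
      intro u _
      obtain ⟨x, rfl⟩ := hsurj u
      obtain ⟨_, hx⟩ : (x : G) ∈ K := hK.symm ▸ x.2
      exact hx

/-- `X_M/Y_M` is abelian and self-centralizing in `G/Y_M`. -/
theorem IsoChiefFactor.cen_eq [Finite G] (hG : Group.IsSolvable G) {M : Subgroup G}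
    (hM : IsCoatom M) (h : IsoChiefFactor V M) : cen G V = chiefTop M := by
  obtain ⟨-, hcomm, -, hcent, -⟩ := chiefTop_structure hG hM
  obtain ⟨φ, hmul, hsurj, hker, hconj⟩ := h.exists_map
  have key : ∀ (g : G) (x : chiefTop M), g • φ x = φ x ↔ g * x * g⁻¹ * (x : G)⁻¹ ∈ M.normalCore := by
    intro g x
    have h1 := hmul (MulAut.conjNormal g x * x⁻¹) x
    rw [inv_mul_cancel_right, hconj] at h1
    rw [h1, add_eq_right, hker]
    simp [MulAut.conjNormal_apply]
  ext g
  rw [mem_cen]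
  constructor
  · exact fun hg => hcent g fun x hx => (key g ⟨x, hx⟩).1 (hg _)
  · intro hg v
    obtain ⟨x, rfl⟩ := hsurj v
    exact (key g x).2 (hcomm g hg x x.2)

/-- Since `G = X_M M` and `X_M ∩ M = Y_M`, writing `g = x m` defines `d g` as the class of `x`. The
cocycle identity holds because `X_M` acts trivially on `V`, so `g` acts as `m`. -/
theorem IsoChiefFactor.exists_der [Finite G] (hG : Group.IsSolvable G) {M : Subgroup G}
    (hM : IsCoatom M) (h : IsoChiefFactor V M) :
    ∃ d : der G V, zeros d = M ∧ ¬ cen G V ≤ zeros d := by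
  obtain ⟨-, -, hXM, -, hnle⟩ := chiefTop_structure hG hM
  have hcen := h.cen_eq hG hM
  obtain ⟨φ, hmul, hsurj, hker, hconj⟩ := h.exists_map
  have hsup : chiefTop M ⊔ M = ⊤ := hM.2 _ (lt_of_le_of_ne le_sup_right fun h =>
    hnle (le_sup_left.trans h.ge))
  have hdec : ∀ g : G, ∃ x : chiefTop M, (x : G)⁻¹ * g ∈ M := fun g => by
    obtain ⟨x, hx, m, hm, rfl⟩ :=
      Subgroup.mem_sup_of_normal_left.1 (hsup.ge (Subgroup.mem_top g))
    exact ⟨⟨x, hx⟩, by simpa using hm⟩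
  choose p hp using hdec
  have huniq : ∀ g (x : chiefTop M), (x : G)⁻¹ * g ∈ M → φ (p g) = φ x := fun g x hx => by
    have h1 : ((x⁻¹ * p g : chiefTop M) : G) ∈ M.normalCore := by
      rw [← hXM]
      refine Subgroup.mem_inf.2 ⟨Subtype.prop _, ?_⟩
      have := M.mul_mem hx (M.inv_mem (hp g))
      rw [Subgroup.coe_mul, Subgroup.coe_inv]
      convert this using 1
      group
    have h2 := hmul x (x⁻¹ * p g)
    rw [(hker _).2 h1, add_zero, mul_inv_cancel_left] at h2
    exact h2
  have hder : ∀ g k : G, φ (p (g * k)) = φ (p g) + g • φ (p k) := fun g k => by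
    obtain ⟨m, hm⟩ : ∃ m, m = (p g : G)⁻¹ * g := ⟨_, rfl⟩
    have h1 : φ (p (g * k)) = φ (p g * MulAut.conjNormal m (p k)) := by
      apply huniq
      have := M.mul_mem (hp g) (hp k)
      rw [Subgroup.coe_mul, MulAut.conjNormal_apply]
      convert this using 1
      rw [hm]
      group
    have h2 : g • φ (p k) = m • φ (p k) := by
      have h3 : g = p g * m := by rw [hm, mul_inv_cancel_left]
      have h4 : (p g : G) ∈ cen G V := hcen.ge (p g).2
      rw [← mem_cen.1 h4 (m • φ (p k)), ← mul_smul, ← h3]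
    rw [h1, hmul, hconj, h2]
  let d : der G V := ⟨fun g => φ (p g), hder⟩
  have hz : zeros d = M := by
    ext g
    constructor
    · intro hg
      have h1 : ((p g : chiefTop M) : G) ∈ M.normalCore := (hker _).1 hg
      have h2 := M.mul_mem (M.normalCore_le h1) (hp g)
      simpa using h2
    · intro hg
      change φ (p g) = 0
      rw [huniq g 1 (by simpa using hg), hker]
      exact one_mem _
  exact ⟨d, hz, by rw [hz, hcen]; exact hnle⟩

end Primitive

/-! ### Assembling the isomorphism classes of modules. -/

theorem normalCore_le_chiefTop {G : Type u} [Group G] (M : Subgroup G) :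
    M.normalCore ≤ chiefTop M := fun g hg => by
  change QuotientGroup.mk' M.normalCore g ∈ socle (G ⧸ M.normalCore)
  have h : QuotientGroup.mk' M.normalCore g = 1 := (QuotientGroup.eq_one_iff g).2 hg
  rw [h]
  exact one_mem _

theorem isEtaIntersection_of_finset {G : Type u} [Group G] {ι : Type*} [Fintype ι]
    {H : Subgroup G} {η : ℝ} (T : ι → Finset (Subgroup G)) (hT : ∀ i, ∀ M ∈ T i, IsCoatom M)
    (hH : H = ⨅ i, ⨅ M ∈ T i, M)
    (hη : ((∏ i, ∏ M ∈ T i, M.index : ℕ) : ℝ) ≤ (H.index : ℝ) ^ η) : IsEtaIntersection η H := by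
  let e := Fintype.equivFin (Σ i, T i)
  refine ⟨Fintype.card (Σ i, T i), fun k => (e.symm k).2.1, fun k => hT _ _ (e.symm k).2.2, ?_, ?_⟩
  · rw [e.symm.iInf_comp (g := fun x : Σ i, T i => x.2.1), iInf_sigma, hH]
    simp only [iInf_subtype]
  · rw [e.symm.prod_comp fun x : Σ i, T i => ((x.2.1.index : ℕ) : ℝ), Fintype.prod_sigma]
    refine le_trans (le_of_eq ?_) hη
    push_cast
    exact Finset.prod_congr rfl fun i _ =>
      Finset.prod_coe_sort (T i) fun M => (M.index : ℝ)

end MaxInt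

theorem theorem1 {G : Type u} [Group G] [Finite G] (hG : Group.IsSolvable G)
    (H : Subgroup G) (hH : MaxInt.IsMaximalIntersection H) (γ : ℕ) (hγ : 0 < γ)
    (hV : ∀ (V : Type u) [AddCommGroup V] [DistribMulAction G V],
      MaxInt.MemV V H → MaxInt.IsGammaModule G V γ) :
    MaxInt.IsEtaIntersection ((γ : ℝ) + 1) H := by
  classical
  open MaxInt in
  choose V instV actV hiso using
    fun M : {M : Subgroup G // IsCoatom M ∧ H ≤ M} => exists_isoChiefFactor hG M.2.1
  have hfin : ∀ M, Finite (V M) := fun M => (hiso M).finite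
  have hirr : ∀ M, IsIrreducibleModule G (V M) := fun M => (hiso M).isIrreducibleModule hG M.2.1
  -- One representative per `G`-isomorphism class, so that each module is counted once in the index
  -- bound.
  let r : Setoid {M : Subgroup G // IsCoatom M ∧ H ≤ M} :=
    { r := fun M M' => ∃ e : V M ≃+ V M', ∀ (g : G) v, e (g • v) = g • e v
      iseqv :=
        ⟨fun M => ⟨AddEquiv.refl _, fun g v => rfl⟩,
         fun {M M'} ⟨e, he⟩ => ⟨e.symm, fun g v => by
          rw [AddEquiv.symm_apply_eq, he, e.apply_symm_apply]⟩,
         fun {M M' M''} ⟨e, he⟩ ⟨f, hf⟩ => ⟨e.trans f, fun g v => by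
          rw [AddEquiv.trans_apply, he, hf, AddEquiv.trans_apply]⟩⟩ }
  have : Fintype (Quotient r) := Fintype.ofFinite _
  let W : Quotient r → Type u := fun q => V q.out
  have hloc : ∀ q : Quotient r, ∃ T : Finset (Subgroup G), (∀ M ∈ T, IsCoatom M ∧ H ≤ M) ∧
      ∏ M ∈ T, M.index ≤ ((commonZeros (W q) H).relIndex (cen G (W q))) ^ (γ + 1) ∧
      ∀ I : Subgroup G, (∀ M ∈ T, I ≤ M) →
        (∀ M, IsCoatom M → cen G (W q) ≤ M → H ≤ M → I ≤ M) →
        ∀ d : der G (W q), H ≤ zeros d → I ≤ zeros d := fun q => by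
    obtain ⟨d, hd, hdC⟩ := (hiso q.out).exists_der hG q.out.2.1
    exact exists_coatoms hG (hirr _)
      (hV (W q) ⟨hirr _, q.out.1, q.out.2.1, q.out.2.2, hiso _⟩) H (hd ▸ q.out.2.2) hdC
  choose T hTc hTi hTz using hloc
  have hprod : ∏ q, (commonZeros (W q) H).relIndex (cen G (W q)) ≤ H.index := by
    have := prod_relIndex_commonZeros_le hG W (fun q => hirr _)
      (fun i j e he => by
        rw [← Quotient.out_eq i, ← Quotient.out_eq j]
        exact Quotient.sound ⟨e, he⟩) H ⊤
    simpa only [top_inf_eq, Subgroup.relIndex_top_right] using this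
  -- Induction on `X = X_M` from above: the maximal subgroups that the local step leaves over
  -- contain `X_M`, and their own `X_{M'}` is strictly larger.
  have hle : ∀ (X : Subgroup G) (M : Subgroup G), X = chiefTop M → IsCoatom M → H ≤ M →
      (⨅ q, ⨅ M ∈ T q, M) ≤ M := by
    intro X
    induction X using WellFoundedGT.induction with
    | ind X ih =>
    rintro M rfl hM hHM
    let q : Quotient r := Quotient.mk r ⟨M, hM, hHM⟩
    obtain ⟨e, he⟩ : r.r q.out ⟨M, hM, hHM⟩ := Quotient.mk_out (s := r) ⟨M, hM, hHM⟩
    have hisoM : IsoChiefFactor (W q) M :=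
      (hiso ⟨M, hM, hHM⟩).trans_addEquiv e.symm fun g v => by
        rw [AddEquiv.symm_apply_eq, he, e.apply_symm_apply]
    obtain ⟨d, hdM, -⟩ := hisoM.exists_der hG hM
    refine (hTz q (⨅ q, ⨅ M ∈ T q, M) (fun M' hM' => iInf_le_of_le q (iInf₂_le M' hM')) (fun M' hM' hC hHM' => ?_)
      d (hHM.trans hdM.ge)).trans hdM.le
    rw [hisoM.cen_eq hG hM] at hC
    refine ih _ ?_ M' rfl hM' hHM'
    -- `X_M ≤ Y_{M'} ≤ X_{M'}`, and equality would put `X_{M'}` inside `M'`.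
    have h1 := Subgroup.normal_le_normalCore.2 hC
    refine lt_of_le_of_ne (h1.trans (normalCore_le_chiefTop M')) fun h => ?_
    exact (chiefTop_structure hG hM').2.2.2.2 (h ▸ hC)
  refine isEtaIntersection_of_finset T (fun q M hM => (hTc q M hM).1) (le_antisymm ?_ ?_) ?_
  · exact le_iInf fun q => le_iInf₂ fun M hM => (hTc q M hM).2
  · obtain ⟨S, hS, rfl⟩ := hH
    exact le_sInf fun M hM => hle _ M rfl (hS M hM) (sInf_le hM)
  · have h1 : ∏ q, ∏ M ∈ T q, M.index ≤ H.index ^ (γ + 1) :=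
      (Finset.prod_le_prod' fun q _ => hTi q).trans (by
        rw [Finset.prod_pow]
        exact Nat.pow_le_pow_left hprod _)
    have h2 : (γ : ℝ) + 1 = ((γ + 1 : ℕ) : ℝ) := by push_cast; rfl
    rw [h2, Real.rpow_natCast]
    exact_mod_cast h1
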